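/- All scalars are complex. Regard $\ell_1(\mathbb{Z})$ as a Banach algebra under convolution, with point masses $\delta_t$ ($t\in\mathbb{Z}$), and let $\langle a,x\rangle=\sum_{t}a(t)x(t)$ for $a\in\ell_1(\mathbb{Z})$, $x\in\ell_\infty(\mathbb{Z})$. A *shift-invariant predual* of $\ell_1(\mathbb{Z})$ is a norm-closed subspace $E\subseteq\ell_\infty(\mathbb{Z})$ such that $E$ is invariant under the bilateral shift and its inverse, and such that the canonical map $\iota_E:\ell_1(\mathbb{Z})\to E^*$, $\iota_E(a)(x)=\langle a,x\rangle$, is an isomorphism of Banach spaces (not necessarily isometric). The weak*-topology on $\ell_1(\mathbb{Z})$ given by $E$ is the one transported from $E^*$ by $\iota_E$. For a Banach space $X$ and $\varepsilon>0$ put $P_0(\varepsilon)=\{\mu\in X^*:\|\mu\|\le 1\}$; let $P_{\alpha+1}(\varepsilon)$ be the weak*-closure of the set of those $\mu\in P_\alpha(\varepsilon)$ for which there is a sequence $(\mu_n)$ in $P_\alpha(\varepsilon)$ with $\mu_n\to\mu$ weak* and $\|\mu_n-\mu\|\ge\varepsilon$ for all $n$; and let $P_\alpha(\varepsilon)=\bigcap_{\beta<\alpha}P_\beta(\varepsilon)$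 for limit ordinals $\alpha$. Let $\eta(\varepsilon,X)$ be the supremum of the countable ordinals $\alpha$ with $P_\alpha(\varepsilon)\ne\emptyset$ (which is $\omega_1$ if these sets are non-empty for every countable $\alpha$). The *Szlenk index* of $X$ is $\eta(X)=\sup_{\varepsilon>0}\eta(\varepsilon,X)$. **Proposition 4.10.** Let $E\subseteq\ell_\infty(\mathbb{Z})$ be a shift-invariant predual of $\ell_1(\mathbb{Z})$. Suppose that $a\in\ell_1(\mathbb{Z})$ is an accumulation point of the set $\{\delta_t:t\in\mathbb{Z}\}$ in the weak*-topology given by $E$ (every weak*-neighbourhood of $a$ contains some $\delta_t\neq a$), and that the convolution powers of $a$ satisfy $\|a^n\|_{\ell_1}\ge 1$ for all $n\in\mathbb{N}$. Then the Szlenk index of $E$ is strictly greater than $\omega$, and $E$ is not isomorphic to $c_0$ as a Banach space. -/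

import Mathlib

open Filter Topology Ordinal
open scoped lp ENNReal ZeroAtInfty

noncomputable section

namespace ShiftPredual

/-- The space `ℓ_1(ℤ)` of absolutely summable complex families, with the `ℓ_1`-norm. -/
abbrev L1 : Type := ℓ^1(ℤ, ℂ)

/-- The space `ℓ_∞(ℤ)` of bounded complex families, with the supremum norm. -/
abbrev LInf : Type := ℓ^∞(ℤ, ℂ)

/-- The space `c_0` of complex sequences tending to `0`, with the supremum norm. -/
abbrev c0 : Type := C₀(ℕ, ℂ)

/-! ### The convolution algebra `ℓ_1(ℤ)` -/

/-- The point mass `δ_t ∈ ℓ_1(ℤ)`. -/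
def delta (t : ℤ) : L1 := lp.single 1 t (1 : ℂ)

/-- The convolution of two absolutely summable families is absolutely summable. -/
theorem memℓp_conv (a b : L1) :
    Memℓp (fun n : ℤ => ∑' k : ℤ, a k * b (n - k)) 1 := by
  have key : ∀ c : L1, Summable fun k : ℤ => ‖c k‖ := fun c => by
    simpa using (lp.memℓp c).summable (by simp)
  have h1 : Summable fun x : ℤ × ℤ => ‖a x.1‖ * ‖b x.2‖ :=
    (key a).mul_of_nonneg (key b) (fun _ => norm_nonneg _) (fun _ => norm_nonneg _)
  have h2 : Summable fun x : ℤ × ℤ => ‖a x.2 * b (x.1 - x.2)‖ := by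
    have hinj : Function.Injective fun x : ℤ × ℤ => (x.2, x.1 - x.2) := by
      rintro ⟨x, y⟩ ⟨x', y'⟩ h
      simp only [Prod.mk.injEq] at h ⊢
      omega
    simpa [Function.comp_def] using h1.comp_injective hinj
  refine memℓp_gen ?_
  simp only [ENNReal.toReal_one, Real.rpow_one]
  refine Summable.of_nonneg_of_le (fun _ => norm_nonneg _) (fun n => ?_) h2.prod
  exact norm_tsum_le_tsum_norm (h2.prod_factor n)

/-- The convolution product on `ℓ_1(ℤ)`: `(a * b)(n) = ∑_k a(k) b(n - k)`. -/
def conv (a b : L1) : L1 := ⟨fun n : ℤ => ∑' k : ℤ, a k * b (n - k), memℓp_conv a b⟩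

/-- The powers `a^n` in the convolution algebra `ℓ_1(ℤ)`, whose unit is `δ_0`. -/
def convPow (a : L1) : ℕ → L1
  | 0 => delta 0
  | n + 1 => conv (convPow a n) a

/-! ### Shift-invariant preduals -/

theorem norm_mul_le_one (_ : ℤ) : ‖ContinuousLinearMap.mul ℂ ℂ‖ ≤ ((1 : NNReal) : ℝ) := by
  simp

/-- The canonical bilinear pairing `⟨a, x⟩ = ∑_t a(t) x(t)` of `ℓ_1(ℤ)` with `ℓ_∞(ℤ)`. -/
def pairing : L1 →L[ℂ] LInf →L[ℂ] ℂ :=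
  lp.dualPairing 1 ∞ (fun _ : ℤ => ContinuousLinearMap.mul ℂ ℂ) norm_mul_le_one

theorem pairing_apply (a : L1) (x : LInf) : pairing a x = ∑' t : ℤ, a t * x t := rfl

/-- The canonical map `ι_E : ℓ_1(ℤ) → E^*`, `⟨ι_E(a), x⟩ = ⟨a, x⟩`, for a subspace `E` of
`ℓ_∞(ℤ)`. -/
def iota (E : Submodule ℂ LInf) : L1 →L[ℂ] StrongDual ℂ E :=
  (E.subtypeL.precomp ℂ).comp pairing

theorem iota_apply (E : Submodule ℂ LInf) (a : L1) (x : E) :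
    iota E a x = ∑' t : ℤ, a t * (x : LInf) t := rfl

/-- A bounded family translated by `m ∈ ℤ` is bounded. -/
theorem memℓp_shift (m : ℤ) (x : LInf) : Memℓp (fun n : ℤ => x (n - m)) ∞ := by
  refine memℓp_infty ⟨‖x‖, ?_⟩
  rintro _ ⟨n, rfl⟩
  exact lp.norm_apply_le_norm ENNReal.top_ne_zero x (n - m)

/-- The `m`-th power, `m ∈ ℤ`, of the bilateral shift on `ℓ_∞(ℤ)`. -/
def shift (m : ℤ) (x : LInf) : LInf := ⟨fun n : ℤ => x (n - m), memℓp_shift m x⟩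

/-- A subspace `E ⊆ ℓ_∞(ℤ)` is a shift-invariant predual of `ℓ_1(ℤ)` if it is closed, the
canonical map `ι_E : ℓ_1(ℤ) → E^*` is an isomorphism of Banach spaces (not necessarily isometric),
and `E` is invariant under the bilateral shift (and its inverse). -/
structure IsShiftInvariantPredual (E : Submodule ℂ LInf) : Prop where
  isClosed : IsClosed (E : Set LInf)
  isInvertible : (iota E).IsInvertible
  shift_mem : ∀ (m : ℤ), ∀ x ∈ E, shift m x ∈ E

/-- The weak*-topology on `ℓ_1(ℤ)` determined by `E`: the weak*-topology of `E^*` pulled back along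
the canonical map `ι_E`. -/
abbrev weakStarTopology (E : Submodule ℂ LInf) : TopologicalSpace L1 :=
  TopologicalSpace.induced (fun a => StrongDual.toWeakDual (iota E a)) inferInstance

/-- `a` is a weak*-accumulation point, with respect to `E`, of the set of point masses: every
weak*-neighbourhood of `a` contains a point mass different from `a`. -/
def IsWeakStarAccPt (E : Submodule ℂ LInf) (a : L1) : Prop :=
  @AccPt L1 (weakStarTopology E) a (𝓟 (Set.range delta))

/-! ### The Szlenk index -/

/-- One step of the Szlenk derivation: the weak*-closure of the set of those `μ ∈ P` that are
the weak*-limit of a sequence `(μ_n)` in `P` with `‖μ_n - μ‖ ≥ ε` for all `n`. -/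
def szlenkDerivative (X : Type*) [NormedAddCommGroup X] [NormedSpace ℂ X] (ε : ℝ)
    (P : Set (WeakDual ℂ X)) : Set (WeakDual ℂ X) :=
  closure {μ | μ ∈ P ∧ ∃ u : ℕ → WeakDual ℂ X, (∀ n, u n ∈ P) ∧ Tendsto u atTop (𝓝 μ) ∧
    ∀ n, ε ≤ ‖WeakDual.toStrongDual (u n) - WeakDual.toStrongDual μ‖}

/-- The sets `P_α(ε)`: `P_0(ε)` is the closed unit ball of `X^*`, `P_{α+1}(ε)` is the Szlenk
derivative of `P_α(ε)`, and `P_α(ε) = ⋂_{β < α} P_β(ε)` at limit ordinals. -/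
def szlenkSet (X : Type*) [NormedAddCommGroup X] [NormedSpace ℂ X] (ε : ℝ) (α : Ordinal.{0}) :
    Set (WeakDual ℂ X) :=
  Ordinal.limitRecOn (motive := fun _ => Set (WeakDual ℂ X)) α
    {μ | ‖WeakDual.toStrongDual μ‖ ≤ 1}
    (fun _ P => szlenkDerivative X ε P)
    (fun o _ P => ⋂ (β : Ordinal.{0}) (h : β < o), P β h)

theorem szlenkSet_zero (X : Type*) [NormedAddCommGroup X] [NormedSpace ℂ X] (ε : ℝ) :
    szlenkSet X ε 0 = {μ | ‖WeakDual.toStrongDual μ‖ ≤ 1} :=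
  Ordinal.limitRecOn_zero ..

theorem szlenkSet_add_one (X : Type*) [NormedAddCommGroup X] [NormedSpace ℂ X] (ε : ℝ)
    (α : Ordinal.{0}) : szlenkSet X ε (α + 1) = szlenkDerivative X ε (szlenkSet X ε α) :=
  Ordinal.limitRecOn_add_one ..

theorem szlenkSet_limit (X : Type*) [NormedAddCommGroup X] [NormedSpace ℂ X] (ε : ℝ)
    (α : Ordinal.{0}) (hα : Order.IsSuccLimit α) :
    szlenkSet X ε α = ⋂ (β : Ordinal.{0}) (_ : β < α), szlenkSet X ε β :=
  Ordinal.limitRecOn_limit _ _ _ _ hα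

/-- `η(ε, X)`: the supremum of the countable ordinals `α` with `P_α(ε)` non-empty. If `P_α(ε)` is
non-empty for all countable `α`, this is the first uncountable ordinal `ω₁`. -/
def szlenkEta (X : Type*) [NormedAddCommGroup X] [NormedSpace ℂ X] (ε : ℝ) : Ordinal.{0} :=
  sSup {α : Ordinal.{0} | α < ω₁ ∧ (szlenkSet X ε α).Nonempty}

/-- The Szlenk index `η(X) = sup_{ε > 0} η(ε, X)`. -/
def szlenkIndex (X : Type*) [NormedAddCommGroup X] [NormedSpace ℂ X] : Ordinal.{0} :=
  ⨆ ε : Set.Ioi (0 : ℝ), szlenkEta X ε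

end ShiftPredual

end

/-!
The accumulation point `a` is a weak*-limit of a sequence `δ_{t k}` with `t k` leaving every finite
set: the dual `E^* ≅ ℓ_1(ℤ)` is separable, so its unit ball is weak*-metrizable. Convolution by an
element of `ℓ_1(ℤ)` is weak*-continuous, because its adjoint on `ℓ_∞(ℤ)` is an absolutely convergent
combination of shifts and so preserves `E`. Hence `a^(n+1) * δ_s` is the weak*-limit of the
translates `a^n * δ_(s + t k)`, all of which lie in the unit ball of `E^*`. As `‖a^(n+1)‖ ≥ 1` while
these translates tend to `0` coordinatewise, their distance to the limit stays above a positive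
constant. This structure, `IsSeparatedTower`, is produced by `exists_isSeparatedTower`, and both
conclusions follow from it for an arbitrary Banach space.

*The Szlenk index.* By induction, half of the `n`-th level of the tower lies in the `n`-th derived
set, and so does any perturbation of it by a functional of norm at most `1 / 2`. A weak*-cluster
point therefore gives a whole ball of radius `1 / 2` inside the `ω`-th set. That ball contains a
separated weak*-convergent sequence, and the set of index `ω + 1` is non-empty. The ball is needed
because the cluster point itself could be `0`
(`IsSeparatedTower.omega0_lt_szlenkIndex`).

*The space `c_0`.* In `c_0^*`, if `φ k → ψ` weak*, then `‖φ k‖` is asymptotically at least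
`‖ψ‖ + ‖φ k - ψ‖` (`c0.eventually_norm_add_norm_sub_le`). Under an isomorphism with `c_0`, the
transported norm would thus drop by a fixed amount at each level of the tower, which is impossible
for infinitely many levels (`IsSeparatedTower.isEmpty_continuousLinearEquiv_c0`).
-/

namespace ShiftPredual

/-! ### Szlenk derivations and separated towers -/

section Szlenk

variable {X : Type*} [NormedAddCommGroup X] [NormedSpace ℂ X]

theorem isClosed_setOf_norm_toStrongDual_le (r : ℝ) :
    IsClosed {μ : WeakDual ℂ X | ‖WeakDual.toStrongDual μ‖ ≤ r} := by
  have h := WeakDual.isClosed_closedBall (𝕜 := ℂ) (0 : StrongDual ℂ X) r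
  convert h using 1
  ext μ
  simp

theorem isCompact_setOf_norm_toStrongDual_le (r : ℝ) :
    IsCompact {μ : WeakDual ℂ X | ‖WeakDual.toStrongDual μ‖ ≤ r} := by
  have h := WeakDual.isCompact_closedBall (𝕜 := ℂ) (0 : StrongDual ℂ X) r
  convert h using 1
  ext μ
  simp

theorem isClosed_szlenkSet (ε : ℝ) (α : Ordinal.{0}) : IsClosed (szlenkSet X ε α) := by
  induction α using Ordinal.limitRecOn with
  | zero => rw [szlenkSet_zero]; exact isClosed_setOf_norm_toStrongDual_le 1
  | add_one α _ => rw [szlenkSet_add_one]; exact isClosed_closure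
  | limit α hα ih =>
    rw [szlenkSet_limit X ε α hα]
    exact isClosed_iInter fun β => isClosed_iInter fun hβ => ih β hβ

theorem szlenkSet_add_one_subset (ε : ℝ) (α : Ordinal.{0}) :
    szlenkSet X ε (α + 1) ⊆ szlenkSet X ε α := by
  rw [szlenkSet_add_one]
  exact closure_minimal (fun μ hμ => hμ.1) (isClosed_szlenkSet ε α)

theorem szlenkSet_natCast_antitone (ε : ℝ) :
    Antitone fun n : ℕ => szlenkSet X ε (n : Ordinal.{0}) :=
  antitone_nat_of_succ_le fun n => by
    rw [Nat.cast_add_one]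
    exact szlenkSet_add_one_subset ε n

theorem mem_szlenkSet_omega0_iff {ε : ℝ} {μ : WeakDual ℂ X} :
    μ ∈ szlenkSet X ε ω ↔ ∀ n : ℕ, μ ∈ szlenkSet X ε (n : Ordinal.{0}) := by
  rw [szlenkSet_limit X ε ω Ordinal.isSuccLimit_omega0]
  simp only [Set.mem_iInter]
  refine ⟨fun h n => h n (Ordinal.natCast_lt_omega0 n), fun h β hβ => ?_⟩
  obtain ⟨n, rfl⟩ := Ordinal.lt_omega0.1 hβ
  exact h n

/-- Only a tail of the sequence has to keep its distance from the limit, and the limit lies in the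
`α`-th set automatically since that set is weak*-closed. -/
theorem mem_szlenkSet_add_one {ε : ℝ} {α : Ordinal.{0}} {μ : WeakDual ℂ X}
    {u : ℕ → WeakDual ℂ X} (hu : ∀ k, u k ∈ szlenkSet X ε α) (hlim : Tendsto u atTop (𝓝 μ))
    (hsep : ∀ᶠ k in atTop, ε ≤ ‖WeakDual.toStrongDual (u k) - WeakDual.toStrongDual μ‖) :
    μ ∈ szlenkSet X ε (α + 1) := by
  obtain ⟨K, hK⟩ := eventually_atTop.1 hsep
  rw [szlenkSet_add_one]
  refine subset_closure ⟨(isClosed_szlenkSet ε α).mem_of_tendsto hlim (.of_forall hu),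
    fun k => u (k + K), fun k => hu _, (tendsto_add_atTop_iff_nat K).2 hlim,
    fun k => hK _ (Nat.le_add_left K k)⟩

theorem lt_szlenkIndex_of_nonempty {ε : ℝ} (hε : 0 < ε) {α β : Ordinal.{0}} (hβ : β < α)
    (hα : α < ω₁) (h : (szlenkSet X ε α).Nonempty) : β < szlenkIndex X := by
  have hbdd : ∀ ε : ℝ, BddAbove {α : Ordinal.{0} | α < ω₁ ∧ (szlenkSet X ε α).Nonempty} :=
    fun ε => ⟨ω₁, fun α hα => hα.1.le⟩
  have hη : ∀ ε : ℝ, szlenkEta X ε ≤ ω₁ := fun ε => csSup_le' fun α hα => hα.1.le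
  refine hβ.trans_le ((le_csSup (hbdd ε) ⟨hα, h⟩).trans ?_)
  exact le_ciSup (f := fun ε : Set.Ioi (0 : ℝ) => szlenkEta X ε)
    ⟨ω₁, by rintro _ ⟨δ, rfl⟩; exact hη δ⟩ ⟨ε, hε⟩

/-- A family of functionals `b n s` in the dual unit ball and a sequence of parameters `t k` such
that each `b (n + 1) s` is the weak*-limit of `b n (s + t k)` as `k → ∞`, while the norm distance
stays at least `d`. -/
structure IsSeparatedTower (b : ℕ → ℤ → WeakDual ℂ X) (t : ℕ → ℤ) (d : ℝ) : Prop where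
  norm_le : ∀ n s, ‖WeakDual.toStrongDual (b n s)‖ ≤ 1
  tendsto : ∀ n s, Tendsto (fun k => b n (s + t k)) atTop (𝓝 (b (n + 1) s))
  separated : ∀ n s, ∀ᶠ k in atTop,
    d ≤ ‖WeakDual.toStrongDual (b n (s + t k)) - WeakDual.toStrongDual (b (n + 1) s)‖

variable {b : ℕ → ℤ → WeakDual ℂ X} {t : ℕ → ℤ} {d : ℝ}

theorem IsSeparatedTower.separated_half_smul (h : IsSeparatedTower b t d) (n : ℕ) (s : ℤ)
    (μ : WeakDual ℂ X) : ∀ᶠ k in atTop, d / 2 ≤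
      ‖WeakDual.toStrongDual ((1 / 2 : ℂ) • b n (s + t k) + μ)
        - WeakDual.toStrongDual ((1 / 2 : ℂ) • b (n + 1) s + μ)‖ := by
  filter_upwards [h.separated n s] with k hk
  have heq : WeakDual.toStrongDual ((1 / 2 : ℂ) • b n (s + t k) + μ)
      - WeakDual.toStrongDual ((1 / 2 : ℂ) • b (n + 1) s + μ) = (1 / 2 : ℂ) •
        (WeakDual.toStrongDual (b n (s + t k)) - WeakDual.toStrongDual (b (n + 1) s)) := by
    ext x
    change (1 / 2 : ℂ) * b n (s + t k) x + μ x - ((1 / 2 : ℂ) * b (n + 1) s x + μ x) =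
      (1 / 2 : ℂ) * (b n (s + t k) x - b (n + 1) s x)
    ring
  rw [heq, norm_smul]
  norm_num
  linarith

theorem IsSeparatedTower.half_smul_add_mem (h : IsSeparatedTower b t d) {μ : WeakDual ℂ X}
    (hμ : ‖WeakDual.toStrongDual μ‖ ≤ 1 / 2) (n : ℕ) (s : ℤ) :
    (1 / 2 : ℂ) • b n s + μ ∈ szlenkSet X (d / 2) (n : Ordinal.{0}) := by
  induction n generalizing s with
  | zero =>
    rw [Nat.cast_zero, szlenkSet_zero, Set.mem_ofPred_eq, map_add, map_smul]
    refine (norm_add_le _ _).trans ?_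
    rw [norm_smul]
    have := h.norm_le 0 s
    norm_num
    linarith
  | succ n ih =>
    rw [Nat.cast_add_one]
    exact mem_szlenkSet_add_one (fun k => ih (s + t k))
      (((h.tendsto n s).const_smul _).add_const μ) (h.separated_half_smul n s μ)

/-- If `c` is a weak*-cluster point of the functionals `b n 0`, the ball of radius `1 / 2` about
`c / 2` lies in the `ω`-th set. That ball contains the sequence `(c + b 0 (t k)) / 2`, whose limit
lies therefore in the set of index `ω + 1`. -/
theorem IsSeparatedTower.omega0_lt_szlenkIndex (h : IsSeparatedTower b t d) (hd : 0 < d) :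
    ω < szlenkIndex X := by
  obtain ⟨c, hc, hcl⟩ := (isCompact_setOf_norm_toStrongDual_le (X := X) 1).exists_mapClusterPt_of_frequently
    (f := fun n : ℕ => b n 0) (l := atTop) (.of_forall fun n => h.norm_le n 0)
  have hball : ∀ μ : WeakDual ℂ X, ‖WeakDual.toStrongDual μ‖ ≤ 1 / 2 →
      (1 / 2 : ℂ) • c + μ ∈ szlenkSet X (d / 2) ω := by
    intro μ hμ
    refine mem_szlenkSet_omega0_iff.2 fun n => ?_
    have hcont : Continuous fun ν : WeakDual ℂ X => (1 / 2 : ℂ) • ν + μ :=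
      (continuous_const_smul _).add continuous_const
    refine (isClosed_szlenkSet (d / 2) (n : Ordinal.{0})).mem_of_mapClusterPt
      (hcl.continuousAt_comp (f := fun ν : WeakDual ℂ X => (1 / 2 : ℂ) • ν + μ)
        hcont.continuousAt) ?_
    filter_upwards [eventually_ge_atTop n] with m hm
    exact szlenkSet_natCast_antitone (d / 2) hm (h.half_smul_add_mem hμ m 0)
  have hcomm : ∀ s, (1 / 2 : ℂ) • b 0 s + (1 / 2 : ℂ) • c ∈ szlenkSet X (d / 2) ω := by
    intro s
    rw [add_comm]
    refine hball _ ?_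
    rw [map_smul, norm_smul]
    have := h.norm_le 0 s
    norm_num
    linarith
  refine lt_szlenkIndex_of_nonempty (half_pos hd) (lt_add_one ω) ?_
    ⟨_, mem_szlenkSet_add_one (fun k => hcomm (0 + t k))
      (((h.tendsto 0 0).const_smul _).add_const _) (h.separated_half_smul 0 0 _)⟩
  rw [← Cardinal.ord_aleph]
  refine (Cardinal.isSuccLimit_ord (Cardinal.aleph0_le_aleph 1)).add_one_lt ?_
  rw [Cardinal.ord_aleph]
  exact Ordinal.omega0_lt_omega_one

end Szlenk

/-! ### Asymptotic additivity of the norm of `c_0^*` -/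

theorem exists_norm_sub_lt_re_apply {X : Type*} [NormedAddCommGroup X] [NormedSpace ℂ X]
    (f : StrongDual ℂ X) {δ : ℝ} (hδ : 0 < δ) : ∃ x : X, ‖x‖ ≤ 1 ∧ ‖f‖ - δ < (f x).re := by
  obtain ⟨x, hx, hfx⟩ := f.exists_lt_apply_of_lt_opNorm (sub_lt_self ‖f‖ hδ)
  obtain ⟨c, hc, hcx⟩ := RCLike.exists_norm_eq_mul_self (f x)
  refine ⟨c • x, by rw [norm_smul, hc, one_mul]; exact hx.le, ?_⟩
  rw [map_smul, _root_.smul_eq_mul, ← hcx]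
  simpa using hfx

theorem re_apply_le_norm {X : Type*} [NormedAddCommGroup X] [NormedSpace ℂ X]
    (f : StrongDual ℂ X) {x : X} (hx : ‖x‖ ≤ 1) : (f x).re ≤ ‖f‖ :=
  (Complex.re_le_norm _).trans ((f.le_opNorm x).trans (mul_le_of_le_one_right (norm_nonneg f) hx))

theorem c0.norm_le {x : c0} {C : ℝ} (hC : 0 ≤ C) : ‖x‖ ≤ C ↔ ∀ n, ‖x n‖ ≤ C := by
  rw [← ZeroAtInftyContinuousMap.norm_toBCF_eq_norm, BoundedContinuousFunction.norm_le hC]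
  rfl

theorem c0.norm_apply_le (x : c0) (n : ℕ) : ‖x n‖ ≤ ‖x‖ :=
  (c0.norm_le (norm_nonneg x)).1 le_rfl n

theorem c0.tendsto_cofinite (x : c0) : Tendsto x cofinite (𝓝 0) := by
  have := x.zero_at_infty'
  rwa [cocompact_eq_cofinite] at this

/-- The `i`-th unit vector of `c_0`. -/
noncomputable def c0.basisVec (i : ℕ) : c0 where
  toFun := Pi.single i 1
  continuous_toFun := continuous_of_discreteTopology
  zero_at_infty' := by
    rw [cocompact_eq_cofinite]
    refine tendsto_const_nhds.congr' ?_
    filter_upwards [(Set.finite_singleton i).compl_mem_cofinite] with n hn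
    exact (Pi.single_eq_of_ne (M := fun _ => ℂ) hn 1).symm

/-- The truncation of `x ∈ c_0` to the coordinates in `F`. -/
noncomputable def c0.truncate (F : Finset ℕ) (x : c0) : c0 := ∑ i ∈ F, x i • c0.basisVec i

theorem c0.truncate_apply (F : Finset ℕ) (x : c0) (n : ℕ) :
    c0.truncate F x n = if n ∈ F then x n else 0 := by
  have h : c0.truncate F x n = ∑ i ∈ F, x i * (Pi.single i (1 : ℂ) : ℕ → ℂ) n := by
    induction F using Finset.induction_on with
    | empty => rfl
    | insert i F hi ih =>
      rw [Finset.sum_insert hi, ← ih, c0.truncate, Finset.sum_insert hi]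
      rfl
  rw [h]
  simp [Pi.single_apply]

theorem c0.norm_apply_truncate_le (f : StrongDual ℂ c0) (F : Finset ℕ) {x : c0} (hx : ‖x‖ ≤ 1) :
    ‖f (c0.truncate F x)‖ ≤ ∑ i ∈ F, ‖f (c0.basisVec i)‖ := by
  rw [c0.truncate, map_sum]
  refine (norm_sum_le _ _).trans (Finset.sum_le_sum fun i _ => ?_)
  rw [map_smul, norm_smul]
  exact mul_le_of_le_one_left (norm_nonneg _) ((c0.norm_apply_le x i).trans hx)

theorem c0.exists_norm_sub_truncate_le (x : c0) {δ : ℝ} (hδ : 0 < δ) :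
    ∃ F : Finset ℕ, ‖x - c0.truncate F x‖ ≤ δ := by
  have hfin := (Metric.tendsto_nhds.1 (c0.tendsto_cofinite x)) δ hδ
  refine ⟨(eventually_cofinite.1 hfin).toFinset, (c0.norm_le hδ.le).2 fun n => ?_⟩
  rw [ZeroAtInftyContinuousMap.sub_apply, c0.truncate_apply]
  split_ifs with h
  · simpa using hδ.le
  · simp only [Set.Finite.mem_toFinset, Set.mem_ofPred_eq, not_not, dist_zero_right] at h
    simpa using h.le

theorem c0.norm_truncate_add_sub_truncate_le (F : Finset ℕ) {x z : c0} (hx : ‖x‖ ≤ 1)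
    (hz : ‖z‖ ≤ 1) : ‖c0.truncate F x + (z - c0.truncate F z)‖ ≤ 1 ∧
      ‖c0.truncate F x - (z - c0.truncate F z)‖ ≤ 1 := by
  constructor <;> refine (c0.norm_le zero_le_one).2 fun n => ?_ <;>
    simp only [ZeroAtInftyContinuousMap.sub_apply, ZeroAtInftyContinuousMap.add_apply,
      c0.truncate_apply] <;> split_ifs
  · simpa using (c0.norm_apply_le x n).trans hx
  · simpa using (c0.norm_apply_le z n).trans hz
  · simpa using (c0.norm_apply_le x n).trans hx
  · simpa using (c0.norm_apply_le z n).trans hz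

/-- The norm of `c_0^*` is asymptotically additive along weak*-convergence: up to `η`, the norm of
`φ k` eventually exceeds that of the limit `ψ` by the norm of `φ k - ψ`. A finitely supported `x`
almost norms `ψ`, and some `z` almost norms `φ k - ψ`; as `φ k - ψ` is small on the finitely many
coordinates `F` carrying `x`, and `ψ` is small off `F`, the vector equal to `x` on `F` and to `z`
off `F` witnesses the inequality. -/
theorem c0.eventually_norm_add_norm_sub_le {ι : Type*} {l : Filter ι} {φ : ι → StrongDual ℂ c0}
    {ψ : StrongDual ℂ c0} (h : ∀ x, Tendsto (fun k => φ k x) l (𝓝 (ψ x))) {η : ℝ} (hη : 0 < η) :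
    ∀ᶠ k in l, ‖ψ‖ + ‖φ k - ψ‖ ≤ ‖φ k‖ + η := by
  -- Seven approximation errors of size `δ` enter the final estimate.
  obtain ⟨δ, hδ, rfl⟩ : ∃ δ : ℝ, 0 < δ ∧ 7 * δ = η := ⟨η / 7, by positivity, by ring⟩
  obtain ⟨x₀, hx₀, hψx₀⟩ := exists_norm_sub_lt_re_apply ψ hδ
  obtain ⟨F, hF⟩ := c0.exists_norm_sub_truncate_le x₀ (δ := δ / (‖ψ‖ + 1)) (by positivity)
  set x := c0.truncate F x₀ with hx
  have hψx : ‖ψ‖ - 2 * δ < (ψ x).re := by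
    have h1 : ‖ψ (x₀ - x)‖ ≤ δ := by
      refine (ψ.le_opNorm_of_le hF).trans ?_
      rw [mul_div_assoc', div_le_iff₀ (by positivity)]
      nlinarith [norm_nonneg ψ]
    have h2 := (Complex.re_le_norm (ψ (x₀ - x))).trans h1
    rw [map_sub, Complex.sub_re] at h2
    linarith
  have hFk : ∀ᶠ k in l, ∑ i ∈ F, ‖(φ k - ψ) (c0.basisVec i)‖ < δ := by
    have : Tendsto (fun k => ∑ i ∈ F, ‖(φ k - ψ) (c0.basisVec i)‖) l (𝓝 (∑ i ∈ F, 0)) := by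
      refine tendsto_finsetSum F fun i _ => ?_
      simpa using ((h (c0.basisVec i)).sub_const (ψ (c0.basisVec i))).norm
    rw [Finset.sum_const_zero] at this
    exact this.eventually_lt_const hδ
  have hxk : ∀ᶠ k in l, (ψ x).re - δ < (φ k x).re :=
    ((Complex.continuous_re.tendsto _).comp (h x)).eventually_const_lt (sub_lt_self _ hδ)
  filter_upwards [hFk, hxk] with k hk hk'
  obtain ⟨z, hz, hφz⟩ := exists_norm_sub_lt_re_apply (φ k - ψ) hδ
  -- `hsub` bounds `ψ` from below on the part of `z` off `F`.
  obtain ⟨hadd, hsub⟩ := c0.norm_truncate_add_sub_truncate_le F hx₀ hz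
  set y := z - c0.truncate F z with hy
  have h1 := re_apply_le_norm (φ k) hadd
  have h2 := re_apply_le_norm ψ hsub
  have h3 := (Complex.re_le_norm _).trans (c0.norm_apply_truncate_le (φ k - ψ) F hz)
  have h4 : (φ k - ψ) z = (φ k y - ψ y) + (φ k - ψ) (c0.truncate F z) := by
    simp only [hy, map_sub, sub_apply]
    ring
  rw [h4, Complex.add_re, Complex.sub_re] at hφz
  rw [map_add, Complex.add_re] at h1
  rw [map_sub, Complex.sub_re] at h2
  linarith

/-- In the norm transported from `c_0^*` the levels of the tower would lose a fixed amount at each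
step. -/
theorem IsSeparatedTower.isEmpty_continuousLinearEquiv_c0 {X : Type*} [NormedAddCommGroup X]
    [NormedSpace ℂ X] {b : ℕ → ℤ → WeakDual ℂ X} {t : ℕ → ℤ} {d : ℝ}
    (h : IsSeparatedTower b t d) (hd : 0 < d) : IsEmpty (X ≃L[ℂ] c0) := by
  refine ⟨fun T => ?_⟩
  let N : WeakDual ℂ X → StrongDual ℂ c0 := fun ν =>
    (WeakDual.toStrongDual ν).comp (T.symm : c0 →L[ℂ] X)
  set C := ‖(T.symm : c0 →L[ℂ] X)‖
  set D := ‖(T : X →L[ℂ] c0)‖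
  have hD : 0 < D + 1 := by positivity
  set d' := d / (D + 1) with hd'
  have hd'pos : 0 < d' := by positivity
  have hNle : ∀ n s, ‖N (b n s)‖ ≤ C := fun n s =>
    (ContinuousLinearMap.opNorm_comp_le _ _).trans
      (mul_le_of_le_one_left (norm_nonneg _) (h.norm_le n s))
  have hsep : ∀ μ ν : WeakDual ℂ X,
      d ≤ ‖WeakDual.toStrongDual μ - WeakDual.toStrongDual ν‖ → d' ≤ ‖N μ - N ν‖ := by
    intro μ ν hμν
    have heq : WeakDual.toStrongDual μ - WeakDual.toStrongDual ν =
        (N μ - N ν).comp (T : X →L[ℂ] c0) := by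
      ext x
      simp [N]
    rw [heq] at hμν
    have := hμν.trans (ContinuousLinearMap.opNorm_comp_le _ _)
    rw [hd', div_le_iff₀ hD]
    nlinarith [norm_nonneg (N μ - N ν)]
  have hstep : ∀ n s, ∃ s', ‖N (b (n + 1) s)‖ + d' / 2 ≤ ‖N (b n s')‖ := by
    intro n s
    have hlim : ∀ x, Tendsto (fun k => N (b n (s + t k)) x) atTop (𝓝 (N (b (n + 1) s) x)) :=
      fun x => ((WeakDual.eval_continuous (T.symm x)).tendsto _).comp (h.tendsto n s)
    obtain ⟨k, hk, hk'⟩ := ((c0.eventually_norm_add_norm_sub_le hlim (half_pos hd'pos)).and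
      (h.separated n s)).exists
    have := hsep _ _ hk'
    exact ⟨s + t k, by linarith⟩
  have hdrop : ∀ n : ℕ, ∀ s, ‖N (b n s)‖ + n * (d' / 2) ≤ C := by
    intro n
    induction n with
    | zero => simpa using hNle 0
    | succ n ih =>
      intro s
      obtain ⟨s', hs'⟩ := hstep n s
      have := ih s'
      push_cast
      linarith
  obtain ⟨n, hn⟩ := exists_nat_gt (C / (d' / 2))
  rw [div_lt_iff₀ (half_pos hd'pos)] at hn
  have := hdrop n 0
  linarith [norm_nonneg (N (b n 0))]

/-! ### Sequences in the weak*-topology -/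

theorem exists_separating_seq (X : Type*) [NormedAddCommGroup X] [NormedSpace ℂ X]
    [TopologicalSpace.SeparableSpace (StrongDual ℂ X)] :
    ∃ x : ℕ → X, ∀ f : StrongDual ℂ X, (∀ n, f (x n) = 0) → f = 0 := by
  let g := TopologicalSpace.denseSeq (StrongDual ℂ X)
  have hx : ∀ n, ∃ x : X, ‖x‖ ≤ 1 ∧ ‖g n‖ / 2 ≤ ‖g n x‖ := by
    intro n
    rcases eq_or_ne (g n) 0 with h0 | h0
    · exact ⟨0, by simp, by simp [h0]⟩
    · obtain ⟨x, hx, hgx⟩ := exists_norm_sub_lt_re_apply (g n) (half_pos (norm_pos_iff.2 h0))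
      exact ⟨x, hx, by linarith [Complex.re_le_norm (g n x)]⟩
  choose x hx1 hx2 using hx
  refine ⟨x, fun f hf => ?_⟩
  by_contra h0
  obtain ⟨n, hn⟩ := (TopologicalSpace.denseRange_denseSeq (StrongDual ℂ X)).exists_dist_lt f
    (ε := ‖f‖ / 3) (by positivity)
  have h1 : ‖g n (x n)‖ ≤ ‖f - g n‖ := by
    have := (f - g n).le_opNorm_of_le (hx1 n)
    rwa [sub_apply, hf n, _root_.zero_sub, norm_neg, mul_one] at this
  have h2 := norm_sub_norm_le f (g n)
  rw [dist_eq_norm] at hn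
  change ‖f - g n‖ < _ at hn
  linarith [hx2 n, norm_pos_iff.2 h0]

/-- Weak*-limits of bounded families of functionals along a filter are reached along sequences when
the dual is norm separable: a countable separating set of vectors determines the weak*-topology on
the unit ball, by compactness. -/
theorem exists_seq_tendsto_weakStar {X ι : Type*} [NormedAddCommGroup X] [NormedSpace ℂ X]
    [TopologicalSpace.SeparableSpace (StrongDual ℂ X)] {l : Filter ι} [l.NeBot] {S : Set ι}
    (hS : S ∈ l) {G : ι → WeakDual ℂ X} (hG : ∀ i, ‖WeakDual.toStrongDual (G i)‖ ≤ 1)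
    {g : WeakDual ℂ X} (hlim : Tendsto G l (𝓝 g)) :
    ∃ t : ℕ → ι, (∀ k, t k ∈ S) ∧ Tendsto (fun k => G (t k)) atTop (𝓝 g) := by
  obtain ⟨x, hx⟩ := exists_separating_seq X
  let ev : WeakDual ℂ X → ℕ → ℂ := fun f n => f (x n)
  have hev : Continuous ev := continuous_pi fun n => WeakDual.eval_continuous (x n)
  have hle : l ≤ comap (ev ∘ G) (𝓝 (ev g)) ⊓ 𝓟 S :=
    le_inf (((hev.tendsto g).comp hlim).le_comap) (le_principal_iff.2 hS)
  have : (comap (ev ∘ G) (𝓝 (ev g)) ⊓ 𝓟 S).NeBot := NeBot.mono ‹_› hle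
  obtain ⟨t₀, ht₀⟩ := exists_seq_tendsto (comap (ev ∘ G) (𝓝 (ev g)) ⊓ 𝓟 S)
  rw [tendsto_inf, tendsto_principal] at ht₀
  obtain ⟨K, hK⟩ := eventually_atTop.1 ht₀.2
  let t : ℕ → ι := fun k => t₀ (k + K)
  have ht : Tendsto (fun k => ev (G (t k))) atTop (𝓝 (ev g)) :=
    (tendsto_comap.comp ht₀.1).comp (tendsto_add_atTop_nat K)
  refine ⟨t, fun k => hK _ (Nat.le_add_left K k), ?_⟩
  refine (isCompact_setOf_norm_toStrongDual_le (X := X) 1).tendsto_nhds_of_unique_mapClusterPt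
    (.of_forall fun k => hG (t k)) fun f _ hf => ?_
  have hcl : MapClusterPt (ev f) atTop (ev ∘ fun k => G (t k)) :=
    hf.continuousAt_comp hev.continuousAt
  have hev_eq : ev f = ev g := by
    have := hcl.neBot.mono (inf_le_inf_left _ ht)
    exact eq_of_nhds_neBot this
  have h0 := hx (WeakDual.toStrongDual f - WeakDual.toStrongDual g) fun n =>
    sub_eq_zero.2 (congrFun hev_eq n)
  exact WeakDual.toStrongDual.injective (sub_eq_zero.1 h0)

/-! ### Translates and convolution in `ℓ_1(ℤ)` -/

theorem L1.hasSum_norm (c : L1) : HasSum (fun k : ℤ => ‖c k‖) ‖c‖ := by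
  simpa using lp.hasSum_norm (p := 1) (by simp) c

instance : TopologicalSpace.SeparableSpace L1 := by
  rw [← TopologicalSpace.isSeparable_univ_iff]
  have hsep : TopologicalSpace.IsSeparable
      (closure (Submodule.span ℂ (Set.range delta) : Set L1)) :=
    ((Set.countable_range delta).isSeparable.span (R := ℂ)).closure
  refine hsep.mono fun c _ => ?_
  refine mem_closure_of_tendsto (lp.hasSum_single ENNReal.one_ne_top c) (.of_forall fun F => ?_)
  refine Submodule.sum_mem _ fun i _ => ?_
  have : lp.single 1 i (c i) = c i • delta i := by
    rw [delta, ← lp.single_smul, _root_.smul_eq_mul, mul_one]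
  rw [this]
  exact Submodule.smul_mem _ _ (Submodule.subset_span ⟨i, rfl⟩)

theorem conv_apply (p q : L1) (n : ℤ) : conv p q n = ∑' k : ℤ, p k * q (n - k) := rfl

theorem conv_delta_apply (p : L1) (s n : ℤ) : conv p (delta s) n = p (n - s) := by
  rw [conv_apply, tsum_eq_single (n - s)]
  · simp [delta]
  · intro k hk
    rw [delta, lp.single_apply_ne, mul_zero]
    omega

theorem conv_delta_delta (p : L1) (s t : ℤ) :
    conv (conv p (delta s)) (delta t) = conv p (delta (s + t)) := by
  refine lp.ext (funext fun n => ?_)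
  rw [conv_delta_apply, conv_delta_apply, conv_delta_apply, _root_.sub_sub, add_comm s t]

theorem conv_conv_delta (p q : L1) (s : ℤ) :
    conv (conv p q) (delta s) = conv (conv p (delta s)) q := by
  refine lp.ext (funext fun n => ?_)
  rw [conv_delta_apply, conv_apply, conv_apply, ← (Equiv.subRight s).tsum_eq]
  refine tsum_congr fun k => ?_
  rw [conv_delta_apply, Equiv.subRight_apply, _root_.sub_sub, _root_.add_sub_cancel]

theorem norm_conv_delta (p : L1) (s : ℤ) : ‖conv p (delta s)‖ = ‖p‖ := by
  refine (L1.hasSum_norm _).unique ?_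
  simp only [conv_delta_apply]
  exact (Equiv.subRight s).hasSum_iff.2 (L1.hasSum_norm p)

/-! ### Weak*-continuity of convolution -/

theorem shift_apply (m : ℤ) (x : LInf) (n : ℤ) : shift m x n = x (n - m) := rfl

theorem norm_shift_le (m : ℤ) (x : LInf) : ‖shift m x‖ ≤ ‖x‖ :=
  lp.norm_le_of_forall_le (norm_nonneg x) fun n =>
    lp.norm_apply_le_norm ENNReal.top_ne_zero x (n - m)

/-- The adjoint of convolution by `q ∈ ℓ_1(ℤ)`, as an operator on `ℓ_∞(ℤ)`: the absolutely
convergent combination of translates of `x` with coefficients `q`. -/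
noncomputable def convAdjoint (q : L1) (x : LInf) : LInf := ∑' m : ℤ, q m • shift (-m) x

theorem summable_smul_shift (q : L1) (x : LInf) : Summable fun m : ℤ => q m • shift (-m) x := by
  refine .of_norm_bounded ((L1.hasSum_norm q).summable.mul_right ‖x‖) fun m => ?_
  rw [norm_smul]
  exact mul_le_mul_of_nonneg_left (norm_shift_le _ x) (norm_nonneg _)

theorem convAdjoint_mem {E : Submodule ℂ LInf} (hE : IsShiftInvariantPredual E) (q : L1)
    {x : LInf} (hx : x ∈ E) : convAdjoint q x ∈ E :=
  hE.isClosed.mem_of_tendsto (summable_smul_shift q x).hasSum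
    (.of_forall fun _ => E.sum_mem fun _ _ => E.smul_mem _ (hE.shift_mem _ x hx))

theorem summable_uncurry_mul_mul (p q : L1) (x : LInf) :
    Summable (Function.uncurry fun m n : ℤ => p m * q (n - m) * x n) := by
  have h1 : Summable fun z : ℤ × ℤ => ‖p z.1‖ * ‖q z.2‖ :=
    (L1.hasSum_norm p).summable.mul_of_nonneg (L1.hasSum_norm q).summable
      (fun _ => norm_nonneg _) (fun _ => norm_nonneg _)
  have hinj : Function.Injective fun z : ℤ × ℤ => (z.1, z.2 - z.1) := by
    rintro ⟨m, n⟩ ⟨m', n'⟩ h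
    simp only [Prod.mk.injEq] at h ⊢
    omega
  refine .of_norm_bounded ((h1.comp_injective hinj).mul_right ‖x‖) fun z => ?_
  simp only [Function.uncurry, norm_mul, Function.comp_apply]
  exact mul_le_mul_of_nonneg_left (lp.norm_apply_le_norm ENNReal.top_ne_zero x _) (by positivity)

theorem pairing_conv (p q : L1) (x : LInf) : pairing (conv p q) x = pairing q (convAdjoint p x) := by
  rw [convAdjoint, (pairing q).map_tsum (summable_smul_shift p x)]
  have h1 : pairing (conv p q) x = ∑' n : ℤ, ∑' m : ℤ, p m * q (n - m) * x n := by
    rw [pairing_apply]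
    exact tsum_congr fun n => by rw [conv_apply, tsum_mul_right]
  rw [h1, (summable_uncurry_mul_mul p q x).tsum_comm]
  refine tsum_congr fun m => ?_
  rw [map_smul, pairing_apply, _root_.smul_eq_mul, ← tsum_mul_left, ← (Equiv.addRight m).tsum_eq]
  refine tsum_congr fun n => ?_
  rw [shift_apply, Equiv.coe_addRight, add_sub_cancel_right, sub_neg_eq_add, mul_assoc]

theorem tendsto_conv_weakStar {E : Submodule ℂ LInf} (hE : IsShiftInvariantPredual E) {ι : Type*}
    {l : Filter ι} {c : ι → L1} {a : L1}
    (h : Tendsto (fun i => StrongDual.toWeakDual (iota E (c i))) l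
      (𝓝 (StrongDual.toWeakDual (iota E a)))) (p : L1) :
    Tendsto (fun i => StrongDual.toWeakDual (iota E (conv p (c i)))) l
      (𝓝 (StrongDual.toWeakDual (iota E (conv p a)))) := by
  rw [tendsto_iff_forall_eval_tendsto_topDualPairing]
  intro x
  have hconv : ∀ q : L1, topDualPairing ℂ E (StrongDual.toWeakDual (iota E (conv p q))) x =
      StrongDual.toWeakDual (iota E q) ⟨convAdjoint p x, convAdjoint_mem hE p x.2⟩ :=
    fun q => pairing_conv p q x
  simp only [hconv]
  exact ((WeakDual.eval_continuous _).tendsto _).comp h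

/-! ### The tower of convolution powers -/

/-- The translates `p * δ_{t k}` converge to `0` coordinatewise, so they cannot cancel more than a
small part of the mass of `q`. -/
theorem eventually_lt_norm_conv_delta_sub {ι : Type*} {l : Filter ι} {t : ι → ℤ}
    (ht : Tendsto t l cofinite) (p q : L1) {r : ℝ} (hr : r < ‖q‖) :
    ∀ᶠ k in l, r < ‖conv p (delta (t k)) - q‖ := by
  obtain ⟨F, hF⟩ := ((L1.hasSum_norm q).eventually_const_lt hr).exists
  have hlim : Tendsto (fun k => ∑ i ∈ F, ‖(conv p (delta (t k)) - q) i‖) l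
      (𝓝 (∑ i ∈ F, ‖q i‖)) := by
    refine tendsto_finsetSum F fun i _ => ?_
    have hp : Tendsto (fun k => p (i - t k)) l (𝓝 0) :=
      (L1.hasSum_norm p).summable.of_norm.tendsto_cofinite_zero.comp
        ((Equiv.subLeft i).injective.tendsto_cofinite.comp ht)
    have := (hp.sub_const (q i)).norm
    rw [_root_.zero_sub, norm_neg] at this
    refine this.congr fun k => ?_
    rw [lp.coeFn_sub, Pi.sub_apply, conv_delta_apply]
  filter_upwards [hlim.eventually_const_lt hF] with k hk
  exact hk.trans_le (sum_le_hasSum F (fun _ _ => norm_nonneg _) (L1.hasSum_norm _))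

theorem norm_iota_delta_le (E : Submodule ℂ LInf) (t : ℤ) : ‖iota E (delta t)‖ ≤ 1 := by
  refine ContinuousLinearMap.opNorm_le_bound _ zero_le_one fun x => ?_
  rw [one_mul, iota_apply, tsum_eq_single t]
  · simpa [delta] using lp.norm_apply_le_norm ENNReal.top_ne_zero (x : LInf) t
  · intro k hk
    rw [delta, lp.single_apply_ne _ _ _ hk, zero_mul]

theorem exists_mul_norm_le_of_isInvertible {F X : Type*} [NormedAddCommGroup F] [NormedSpace ℂ F]
    [NormedAddCommGroup X] [NormedSpace ℂ X] {f : F →L[ℂ] StrongDual ℂ X} (hf : f.IsInvertible) :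
    ∃ c : ℝ, 0 < c ∧ ∀ u : F, c * ‖u‖ ≤ ‖f u‖ := by
  obtain ⟨e, rfl⟩ := hf
  obtain ⟨C, hC, hbound⟩ := SemilinearMapClass.bound_of_continuous e.symm e.symm.continuous
  refine ⟨C⁻¹, inv_pos.2 hC, fun u => ?_⟩
  rw [inv_mul_le_iff₀ hC]
  simpa using hbound (e u)

/-- A weak*-accumulation point of the point masses is the limit of a sequence `δ_{t k}` with `t k`
leaving every finite set. -/
theorem IsWeakStarAccPt.exists_seq {E : Submodule ℂ LInf} (hE : IsShiftInvariantPredual E)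
    {a : L1} (ha : IsWeakStarAccPt E a) : ∃ t : ℕ → ℤ, Tendsto t atTop cofinite ∧
      Tendsto (fun k => StrongDual.toWeakDual (iota E (delta (t k)))) atTop
        (𝓝 (StrongDual.toWeakDual (iota E a))) := by
  obtain ⟨e, he⟩ := hE.isInvertible
  have : TopologicalSpace.SeparableSpace (StrongDual ℂ E) :=
    e.surjective.denseRange.separableSpace e.continuous
  let G : ℤ → WeakDual ℂ E := fun t => StrongDual.toWeakDual (iota E (delta t))
  let g : WeakDual ℂ E := StrongDual.toWeakDual (iota E a)
  let S : Set ℤ := {t | delta t ≠ a}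
  have hne : (comap G (𝓝 g) ⊓ 𝓟 S).NeBot := by
    rw [← frequently_mem_iff_neBot, frequently_comap]
    have hfreq := (@accPt_iff_frequently L1 (weakStarTopology E) a (Set.range delta)).1 ha
    rw [nhds_induced, frequently_comap] at hfreq
    refine hfreq.mono ?_
    rintro μ ⟨_, rfl, hy, t, rfl⟩
    exact ⟨t, rfl, hy⟩
  obtain ⟨t, htS, ht⟩ := exists_seq_tendsto_weakStar (l := comap G (𝓝 g) ⊓ 𝓟 S)
    (mem_inf_of_right (mem_principal_self S)) (norm_iota_delta_le E)
    (tendsto_comap.mono_left inf_le_left)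
  refine ⟨t, le_cofinite_iff_eventually_ne.2 fun i => ?_, ht⟩
  rw [eventually_map]
  -- A value `i` taken infinitely often would force `δ_i = a`, which the choice of `S` excludes.
  by_cases hi : delta i = a
  · exact .of_forall fun k hk => htS k (hk ▸ hi)
  · have hGi : g ≠ G i := fun h => hi (by
      have h' : iota E a = iota E (delta i) := h
      rw [← he] at h'
      exact (e.injective h').symm)
    filter_upwards [ht.eventually_ne hGi] with k hk hki
    exact hk (congrArg G hki)

/-- The tower whose `n`-th level consists of the translates of the convolution power `a^n`. -/
theorem exists_isSeparatedTower {E : Submodule ℂ LInf} (hE : IsShiftInvariantPredual E) {a : L1}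
    (ha : IsWeakStarAccPt E a) (hpow : ∀ n : ℕ, 1 ≤ ‖convPow a n‖) :
    ∃ (b : ℕ → ℤ → WeakDual ℂ E) (t : ℕ → ℤ) (d : ℝ), 0 < d ∧ IsSeparatedTower b t d := by
  obtain ⟨t, ht, hlim⟩ := ha.exists_seq hE
  obtain ⟨c, hc, hle⟩ := exists_mul_norm_le_of_isInvertible hE.isInvertible
  let b : ℕ → ℤ → WeakDual ℂ E := fun n s =>
    StrongDual.toWeakDual (iota E (conv (convPow a n) (delta s)))
  have htendsto : ∀ n s, Tendsto (fun k => b n (s + t k)) atTop (𝓝 (b (n + 1) s)) := by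
    intro n s
    have h := tendsto_conv_weakStar hE hlim (conv (convPow a n) (delta s))
    rw [← conv_conv_delta] at h
    simp only [conv_delta_delta] at h
    exact h
  refine ⟨b, t, c * (1 / 2), by positivity, ?_, htendsto, fun n s => ?_⟩
  · intro n
    induction n with
    | zero =>
      intro s
      have h : conv (delta 0) (delta s) = delta s := by
        refine lp.ext (funext fun n => ?_)
        rw [conv_delta_apply, delta, delta]
        by_cases hns : n = s
        · subst hns
          rw [_root_.sub_self, lp.single_apply_self, lp.single_apply_self]
        · rw [lp.single_apply_ne _ _ _ hns, lp.single_apply_ne _ _ _ (sub_ne_zero.2 hns)]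
      change ‖iota E (conv (delta 0) (delta s))‖ ≤ 1
      rw [h]
      exact norm_iota_delta_le E s
    | succ n ih =>
      exact fun s => (isClosed_setOf_norm_toStrongDual_le (X := E) 1).mem_of_tendsto
        (htendsto n s) (.of_forall fun k => ih (s + t k))
  · have hst : Tendsto (fun k => s + t k) atTop cofinite :=
      (add_right_injective s).tendsto_cofinite.comp ht
    have hq : 1 / 2 < ‖conv (convPow a (n + 1)) (delta s)‖ := by
      rw [norm_conv_delta]
      linarith [hpow (n + 1)]
    filter_upwards [eventually_lt_norm_conv_delta_sub hst (convPow a n) _ hq] with k hk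
    change _ ≤ ‖iota E (conv (convPow a n) (delta (s + t k))) -
      iota E (conv (convPow a (n + 1)) (delta s))‖
    rw [← map_sub]
    exact (mul_le_mul_of_nonneg_left hk.le hc.le).trans (hle _)

end ShiftPredual


theorem proposition4p10 (E : Submodule ℂ ShiftPredual.LInf)
    (hE : ShiftPredual.IsShiftInvariantPredual E)
    (a : ShiftPredual.L1) (ha : ShiftPredual.IsWeakStarAccPt E a)
    (hpow : ∀ n : ℕ, 1 ≤ ‖ShiftPredual.convPow a n‖) :
    ω < ShiftPredual.szlenkIndex E ∧ IsEmpty (E ≃L[ℂ] ShiftPredual.c0) := by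
  obtain ⟨b, t, d, hd, h⟩ := ShiftPredual.exists_isSeparatedTower hE ha hpow
  exact ⟨h.omega0_lt_szlenkIndex hd, h.isEmpty_continuousLinearEquiv_c0 hd⟩
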